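/- Let $X$, $Y$ be compact metric spaces and let $\phi_t:X\to X$, $\psi_t:Y\to Y$ ($t\in\mathbb R$) be continuous flows without fixed points. A \emph{flow box} of $\phi_t$ is an open set $U\subset X$ for which there are $\varepsilon>0$ and a subset $T\subset U$, closed in $U$, such that $(x,s)\mapsto\phi_s(x)$ is a homeomorphism from $T\times(-\varepsilon,\varepsilon)$ onto $U$; such a set $T$ is called a \emph{transversal}. A finite family of transversals is \emph{complete} if every point of the space lies in the orbit of a point of one of them. A Borel measure $\mu$ on $X$ is \emph{invariant} if $\mu(\phi_t(A))=\mu(A)$ for all $t\in\mathbb R$ and all Borel sets $A\subset X$. A finite invariant measure $\mu$ induces on every transversal $T$ the finite Borel measure $$\mu_T(A)=\frac{\mu(\phi_{(-\varepsilon,\varepsilon)}(A))}{2\varepsilon},\qquad A\subset T \text{ Borel},$$ where $\phi_{(-\varepsilon,\varepsilon)}(T)$ is any flow box with transversal $T$ as above (the value does not depend on $\varepsilon$). The same notions are used for $\psi_t$. A flow is \emph{uniquely ergodic} if it has exactly one invariant Borel probability measure. Let $(T_i)_{1\le i\le n}$ and $(T_i')_{1\le i\le n}$ be complete families of transversals for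 $\phi_t$ and $\psi_t$, respectively. Let $F:\bigsqcup_{i=1}^n T_i\to\bigsqcup_{i=1}^n T_i'$ be a map of the disjoint unions which restricts, for every $i$, to a homeomorphism $F|_{T_i}$ from $T_i$ onto $T_i'$, and which preserves the holonomy: for all $x,y\in\bigsqcup_i T_i$, the points $x$ and $y$ lie in the same orbit of $\phi_t$ if and only if $F(x)$ and $F(y)$ lie in the same orbit of $\psi_t$. Then there is a bijection $\Theta$ from the set of finite Borel measures on $X$ invariant by $\phi_t$ onto the set of finite Borel measures on $Y$ invariant by $\psi_t$, induced by $F$ in the following sense: for finite invariant Borel measures $\mu$ of $\phi_t$ and $\nu$ of $\psi_t$, one has $\Theta(\mu)=\nu$ if and only if $(F|_{T_i})_*\,\mu_{T_i}=\nu_{T_i'}$ for every $i\in\{1,\dots,n\}$. In particular, $\phi_t$ is uniquely ergodic if and only if $\psi_t$ is uniquely ergodic. -/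

import Mathlib

open Set MeasureTheory

/-- The flow `φ` has no fixed points: no point is fixed by all the maps `φ t`. -/
def Flow.HasNoFixedPoints {X : Type*} [TopologicalSpace X] (φ : Flow ℝ X) : Prop :=
  ∀ x : X, ¬ ∀ t : ℝ, φ t x = x

/-- `U` is a flow box of the flow `φ`, of size `ε`, with transversal `T`: `U` is open in `X`, `T` is
a subset of `U` which is closed in `U`, `ε > 0`, and `(x, s) ↦ φ s x` is a homeomorphism from
`T × (-ε, ε)` onto `U`. -/
structure Flow.IsFlowBox {X : Type*} [TopologicalSpace X] (φ : Flow ℝ X)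
    (U T : Set X) (ε : ℝ) : Prop where
  isOpen : IsOpen U
  subset : T ⊆ U
  isClosed : IsClosed {u : U | (u : X) ∈ T}
  pos : 0 < ε
  homeo : ∃ Φ : (T × Ioo (-ε) ε) ≃ₜ U, ∀ (x : T) (s : Ioo (-ε) ε), (Φ (x, s) : X) = φ s x

/-- `T` is a transversal of `φ`: it is the transversal of some flow box. -/
def Flow.IsTransversal {X : Type*} [TopologicalSpace X] (φ : Flow ℝ X) (T : Set X) : Prop :=
  ∃ (U : Set X) (ε : ℝ), φ.IsFlowBox U T ε

/-- `T₁, …, Tₙ` is a complete set of transversals: each `T i` is a transversal, and every point of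
`X` lies in the orbit of a point of some `T i`. -/
def Flow.IsCompleteTransversals {X : Type*} [TopologicalSpace X] (φ : Flow ℝ X) {n : ℕ}
    (T : Fin n → Set X) : Prop :=
  (∀ i, φ.IsTransversal (T i)) ∧ ∀ x : X, ∃ i, ∃ y ∈ T i, x ∈ φ.orbit y

/-- The maps `F i : T i → T' i`, seen as one map on the disjoint union of the `T i`, preserve the
holonomy: two points of the disjoint union lie in the same orbit of `φ` if and only if their images
lie in the same orbit of `ψ`. -/
def PreservesHolonomy {X Y : Type*} [TopologicalSpace X] [TopologicalSpace Y]
    (φ : Flow ℝ X) (ψ : Flow ℝ Y) {n : ℕ} {T : Fin n → Set X} {T' : Fin n → Set Y}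
    (F : ∀ i, T i → T' i) : Prop :=
  ∀ (i j : Fin n) (x : T i) (y : T j),
    (y : X) ∈ φ.orbit (x : X) ↔ (F j y : Y) ∈ ψ.orbit (F i x : Y)

/-- The measure `μ` is invariant by the flow: `μ (φ t (A)) = μ A` for all times `t` and all Borel
sets `A`. -/
def Flow.IsInvariantMeasure {X : Type*} [TopologicalSpace X] [MeasurableSpace X]
    (φ : Flow ℝ X) (μ : Measure X) : Prop :=
  ∀ (t : ℝ) (A : Set X), MeasurableSet A → μ (φ t '' A) = μ A

/-- The finite measures which are invariant by the flow. -/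
def Flow.FiniteInvariantMeasure {X : Type*} [TopologicalSpace X] [MeasurableSpace X]
    (φ : Flow ℝ X) : Type _ :=
  {μ : Measure X // IsFiniteMeasure μ ∧ φ.IsInvariantMeasure μ}

/-- The flow is uniquely ergodic: it has exactly one invariant probability measure. -/
def Flow.IsUniquelyErgodic {X : Type*} [TopologicalSpace X] [MeasurableSpace X]
    (φ : Flow ℝ X) : Prop :=
  ∃! μ : Measure X, IsProbabilityMeasure μ ∧ φ.IsInvariantMeasure μ

/-- The value `μ_T(A) = μ (φ_(-ε, ε) (A)) / (2 ε)` of the measure induced by `μ` on a transversal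
`T`, for a subset `A` of `T`, where `ε` is the size of a flow box with transversal `T`. (When `μ` is
invariant, this does not depend on the flow box.) -/
noncomputable def Flow.transverseMeasure {X : Type*} [TopologicalSpace X] [MeasurableSpace X]
    (φ : Flow ℝ X) (μ : Measure X) {T : Set X} (ε : ℝ) (A : Set T) : ENNReal :=
  μ {z : X | ∃ x ∈ A, ∃ s ∈ Ioo (-ε) ε, z = φ s x} / ENNReal.ofReal (2 * ε)

/-- The maps `F i : T i → T' i` carry the measures induced by `μ` on the transversals `T i` to the
measures induced by `ν` on the transversals `T' i`: one has `μ_{T i} (F i ⁻¹ (B)) = ν_{T' i} (B)` for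
all Borel subsets `B` of `T' i`, that is, `(F i)_* μ_{T i} = ν_{T' i}`. -/
def CarriesTransverseMeasures {X Y : Type*} [TopologicalSpace X] [TopologicalSpace Y]
    [MeasurableSpace X] [MeasurableSpace Y] (φ : Flow ℝ X) (ψ : Flow ℝ Y) {n : ℕ}
    {T : Fin n → Set X} {T' : Fin n → Set Y} (F : ∀ i, T i → T' i)
    (μ : Measure X) (ν : Measure Y) : Prop :=
  ∀ (i : Fin n) (U : Set X) (ε : ℝ) (U' : Set Y) (ε' : ℝ),
    φ.IsFlowBox U (T i) ε → ψ.IsFlowBox U' (T' i) ε' →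
    ∀ B : Set (T' i), MeasurableSet B →
      φ.transverseMeasure μ ε (F i ⁻¹' B) = ψ.transverseMeasure ν ε' B

open MeasurableSpace (CountablySeparated)

/-!
Let `Z` be the disjoint union of the transversals, with the relation of lying on the same orbit.
Sweeping `Z` along the flow gives a surjection `Z × ℝ → X` which is countable-to-one, because the
points of one transversal return to it only after a definite time. A finite invariant measure `μ` on
`X` therefore lifts to a measure on `Z × ℝ` which restricts to `μ` on the sets where the sweeping
map is injective. The lift is invariant under the translations of `ℝ`, so it is the product of a
finite measure `m` on `Z` with Lebesgue measure, and `m` gives the transverse measures of `μ`.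

Conversely, `m × dt` is the lift of a measure on `X` if and only if it is preserved by the partial
Borel isomorphisms of `Z × ℝ` over `X`. Locally these are holonomies of `Z`, accompanied by a
translation of `ℝ` that depends on the point, so the condition is that `m` is preserved by the
partial Borel isomorphisms of `Z` which move each point inside its orbit. Thus the finite invariant
measures of the flow only depend on the Borel space `Z` with its orbit relation, which `F`
preserves.

The bijection obtained in this way commutes with scaling, and a flow is uniquely ergodic if and only
if its finite invariant measures are the multiples of a single nonzero one.
-/

section PartialInjections

variable {α β : Type*} [MeasurableSpace α] [MeasurableSpace β]

/-- The pullback of a measure `ν` along the restriction of `f` to a set `C` on which `f` is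
injective: the measure `A ↦ ν (f '' (A ∩ C))`. -/
noncomputable def pullbackOn (f : α → β) (C : Set α) (ν : Measure β) : Measure α :=
  (ν.comap (C.domRestrict f)).map (↑)

instance (f : α → β) (C : Set α) (ν : Measure β) [IsFiniteMeasure ν] :
    IsFiniteMeasure (pullbackOn f C ν) := by
  unfold pullbackOn
  infer_instance

variable [StandardBorelSpace α] [CountablySeparated β] {f : α → β} {C : Set α}

theorem measurableEmbedding_domRestrict (hf : Measurable f) (hC : MeasurableSet C)
    (hinj : InjOn f C) : MeasurableEmbedding (C.domRestrict f) :=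
  have := hC.standardBorel
  (hf.comp measurable_subtype_coe).measurableEmbedding (injOn_iff_injective.1 hinj)

theorem exists_measurable_leftInvOn [Nonempty α] (hf : Measurable f) (hC : MeasurableSet C)
    (hinj : InjOn f C) : ∃ R : β → α, Measurable R ∧ LeftInvOn R f C := by
  obtain ⟨R, hR, h⟩ := (measurableEmbedding_domRestrict hf hC hinj).exists_measurable_extend
    measurable_subtype_coe fun _ => inferInstance
  exact ⟨R, hR, fun a ha => congrFun h ⟨a, ha⟩⟩

theorem pullbackOn_apply (hf : Measurable f) (hC : MeasurableSet C) (hinj : InjOn f C)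
    (ν : Measure β) {A : Set α} (hA : MeasurableSet A) :
    pullbackOn f C ν A = ν (f '' (A ∩ C)) := by
  rw [pullbackOn, Measure.map_apply measurable_subtype_coe hA,
    (measurableEmbedding_domRestrict hf hC hinj).comap_apply, image_domRestrict]

theorem measure_image_eq_of_countable_cover {κ : Type*} [Countable κ] (hf : Measurable f)
    (hC : MeasurableSet C) (hinj : InjOn f C) {μ : Measure α} {ν : Measure β} {S : κ → Set α}
    (hS : ∀ k, MeasurableSet (S k)) (hCS : C ⊆ ⋃ k, S k)
    (h : ∀ k A, MeasurableSet A → A ⊆ C ∩ S k → ν (f '' A) = μ A) : ν (f '' C) = μ C := by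
  have hpieces : (μ.restrict C).restrict (⋃ k, S k) =
      (pullbackOn f C ν).restrict (⋃ k, S k) := by
    refine Measure.restrict_iUnion_congr.2 fun k => ?_
    ext A hA
    have hAS := hA.inter (hS k)
    rw [Measure.restrict_apply hA, Measure.restrict_apply hA, Measure.restrict_apply hAS,
      pullbackOn_apply hf hC hinj ν hAS, h k _ (hAS.inter hC)]
    exact fun a ha => ⟨ha.2, ha.1.2⟩
  have hCC := DFunLike.congr_fun hpieces C
  rw [Measure.restrict_apply hC, Measure.restrict_apply hC, inter_eq_left.2 hCS,
    Measure.restrict_apply hC, pullbackOn_apply hf hC hinj ν hC, inter_self] at hCC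
  exact hCC.symm

end PartialInjections

section RelInvariant

variable {α β : Type*} [MeasurableSpace α] [MeasurableSpace β]

/-- The measure `m` is invariant under the relation `r`: every partial measurable isomorphism whose
graph is contained in `r` preserves it. -/
def IsRelInvariant (r : α → α → Prop) (m : Measure α) : Prop :=
  ∀ (C : Set α) (g : α → α), MeasurableSet C → Measurable g → InjOn g C →
    (∀ a ∈ C, r a (g a)) → m (g '' C) = m C

/-- The finite measures which are invariant under the relation `r`. -/
def FiniteRelInvariantMeasure (r : α → α → Prop) : Type _ :=
  {m : Measure α // IsFiniteMeasure m ∧ IsRelInvariant r m}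

theorem IsRelInvariant.map {r : α → α → Prop} {r' : β → β → Prop} {m : Measure α}
    (hm : IsRelInvariant r m) (e : α ≃ᵐ β) (he : ∀ a a', r' (e a) (e a') → r a a') :
    IsRelInvariant r' (m.map e) := by
  intro C g hC hg hinj hr
  have himage : e ⁻¹' (g '' C) = (e.symm ∘ g ∘ e) '' (e ⁻¹' C) := by
    rw [image_comp, image_comp, e.surjective.image_preimage, e.symm.image_eq_preimage_symm]
    rfl
  rw [e.map_apply, e.map_apply, himage]
  refine hm _ _ (e.measurable hC) (e.symm.measurable.comp (hg.comp e.measurable)) ?_ fun a ha => ?_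
  · exact e.symm.injective.comp_injOn (hinj.comp e.injective.injOn (mapsTo_preimage e C))
  · exact he _ _ (by simpa using hr _ ha)

/-- The bijection between finite invariant measures induced by an isomorphism of relations. -/
noncomputable def FiniteRelInvariantMeasure.congr {r : α → α → Prop} {r' : β → β → Prop}
    (e : α ≃ᵐ β) (he : ∀ a a', r a a' ↔ r' (e a) (e a')) :
    FiniteRelInvariantMeasure r ≃ FiniteRelInvariantMeasure r' where
  toFun m := ⟨m.1.map e, have := m.2.1; inferInstance, m.2.2.map e fun a a' => (he a a').2⟩
  invFun m := ⟨m.1.map e.symm, have := m.2.1; inferInstance,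
    m.2.2.map e.symm fun b b' h => by simpa [he] using h⟩
  left_inv m := Subtype.ext (e.map_symm_map)
  right_inv m := Subtype.ext (e.map_map_symm)

end RelInvariant

section Lifts

variable {α β κ : Type*} [MeasurableSpace α] [MeasurableSpace β] [MeasurableSpace κ]

/-- The map `f` is measurable and injective on each level set of the measurable map `q`. For a
countable index type `κ` this presents `f` as a countable-to-one map. -/
structure IsPiecewiseInjective (f : α → β) (q : α → κ) : Prop where
  measurable : Measurable f
  measurable_index : Measurable q
  eq_of_eq : ∀ ⦃a b : α⦄, q a = q b → f a = f b → a = b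

/-- The measure `N` is the lift of `μ` along `f`: on the sets where `f` is injective, `f` carries
`N` to `μ`. For a countable-to-one map `f` this means that `N` is the integral over `μ` of the
counting measures of the fibres. -/
def IsLift (f : α → β) (N : Measure α) (μ : Measure β) : Prop :=
  ∀ C, MeasurableSet C → InjOn f C → N C = μ (f '' C)

variable {f : α → β} {q : α → κ} {N N' : Measure α} {μ μ' : Measure β}

theorem IsPiecewiseInjective.injOn (hf : IsPiecewiseInjective f q) (k : κ) :
    InjOn f (q ⁻¹' {k}) :=
  fun _ ha _ ha' he => hf.eq_of_eq (ha.trans ha'.symm) he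

theorem IsLift.map (h : IsLift f N μ) (τ : α ≃ᵐ α) (θ : β ≃ᵐ β) (hτθ : f ∘ τ = θ ∘ f) :
    IsLift f (N.map τ) (μ.map θ) := by
  intro C hC hinj
  have himage : θ ⁻¹' (f '' C) = f '' (τ ⁻¹' C) := by
    apply θ.injective.image_injective
    rw [θ.surjective.image_preimage, ← image_comp, ← hτθ, image_comp,
      τ.surjective.image_preimage]
  have hinj' : InjOn (f ∘ τ) (τ ⁻¹' C) :=
    hinj.comp τ.injective.injOn (mapsTo_preimage τ C)
  rw [τ.map_apply, θ.map_apply, himage,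
    h _ (τ.measurable hC) (InjOn.of_comp (g := θ) (hτθ ▸ hinj'))]

theorem iUnion_preimage_singleton_eq_univ {α κ : Type*} (q : α → κ) : ⋃ k, q ⁻¹' {k} = univ :=
  iUnion_eq_univ_iff.2 fun a => ⟨q a, rfl⟩

theorem IsPiecewiseInjective.measurableSet_piece [MeasurableSingletonClass κ]
    (hf : IsPiecewiseInjective f q) (k : κ) :
    MeasurableSet (q ⁻¹' {k}) :=
  hf.measurable_index (measurableSet_singleton k)

theorem IsPiecewiseInjective.exists_leftInvOn [MeasurableSingletonClass κ] [StandardBorelSpace α]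
    [CountablySeparated β] [Nonempty α] (hf : IsPiecewiseInjective f q) :
    ∃ R : κ → β → α, (∀ k, Measurable (R k)) ∧ ∀ k, LeftInvOn (R k) f (q ⁻¹' {k}) := by
  choose R hR hinv using fun k =>
    exists_measurable_leftInvOn hf.measurable (hf.measurableSet_piece k) (hf.injOn k)
  exact ⟨R, hR, hinv⟩

variable [Countable κ] [MeasurableSingletonClass κ]

theorem IsLift.unique_left (hf : IsPiecewiseInjective f q) (h : IsLift f N μ)
    (h' : IsLift f N' μ) : N = N' := by
  refine (Measure.ext_iff_of_iUnion_eq_univ (iUnion_preimage_singleton_eq_univ q)).2 fun k => ?_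
  ext A hA
  have hAk := hA.inter (hf.measurableSet_piece k)
  have hinj := (hf.injOn k).mono (inter_subset_right (s := A))
  rw [Measure.restrict_apply hA, Measure.restrict_apply hA, h _ hAk hinj, h' _ hAk hinj]

theorem IsLift.measure_image_le (hf : IsPiecewiseInjective f q) (h : IsLift f N μ) {C : Set α}
    (hC : MeasurableSet C) : μ (f '' C) ≤ N C := by
  have hpiece := fun k => hC.inter (hf.measurableSet_piece k)
  have hdisj : Pairwise (Function.onFun Disjoint fun k => C ∩ q ⁻¹' {k}) := fun k l hkl =>
    disjoint_left.2 fun a ha ha' => hkl (ha.2.symm.trans ha'.2)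
  have hC_eq : C = ⋃ k, C ∩ q ⁻¹' {k} := by
    rw [← inter_iUnion, iUnion_preimage_singleton_eq_univ, inter_univ]
  calc μ (f '' C)
      ≤ ∑' k, μ (f '' (C ∩ q ⁻¹' {k})) := by
        conv_lhs => rw [hC_eq, image_iUnion]
        exact measure_iUnion_le _
    _ = ∑' k, N (C ∩ q ⁻¹' {k}) := tsum_congr fun k =>
        (h _ (hpiece k) ((hf.injOn k).mono inter_subset_right)).symm
    _ = N C := by
        conv_rhs => rw [hC_eq, measure_iUnion hdisj hpiece]

theorem IsLift.isRelInvariant [StandardBorelSpace α] (hf : IsPiecewiseInjective f q)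
    (h : IsLift f N μ) : IsRelInvariant (fun a a' => f a' = f a) N := by
  intro C g hC hg hinj hfg
  refine measure_image_eq_of_countable_cover hg hC hinj hf.measurableSet_piece
    (by simp [iUnion_preimage_singleton_eq_univ]) fun k A hA hAC => ?_
  have hfgA : EqOn (f ∘ g) f A := fun a ha => hfg a (hAC ha).1
  have hinjf : InjOn f A := (hf.injOn k).mono fun a ha => (hAC ha).2
  have hinjg : InjOn f (g '' A) := (hinjf.congr hfgA.symm).image_of_comp
  have hgA := hA.image_of_measurable_injOn hg (hinj.mono fun a ha => (hAC ha).1)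
  rw [h _ hgA hinjg, h _ hA hinjf, ← image_comp, hfgA.image_eq]

variable [StandardBorelSpace α] [CountablySeparated β]

theorem IsPiecewiseInjective.exists_rightInverse (hf : IsPiecewiseInjective f q)
    (hsurj : Function.Surjective f) :
    ∃ s : β → α, MeasurableEmbedding s ∧ Function.LeftInverse f s := by
  classical
  rcases isEmpty_or_nonempty α with hα | hα
  · have := Function.Surjective.isEmpty hsurj
    exact ⟨isEmptyElim, ⟨Function.injective_of_subsingleton _, measurable_of_empty _,
      fun A _ => by simp [eq_empty_of_isEmpty A]⟩, isEmptyElim⟩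
  obtain ⟨R, hR, hinv⟩ := hf.exists_leftInvOn
  have : Nonempty κ := hα.map q
  obtain ⟨e, he⟩ := exists_surjective_nat κ
  have hfind : ∀ b, ∃ n, b ∈ f '' (q ⁻¹' {e n}) := by
    intro b
    obtain ⟨a, rfl⟩ := hsurj b
    obtain ⟨n, hn⟩ := he (q a)
    exact ⟨n, mem_image_of_mem f hn.symm⟩
  let s : β → α := fun b => R (e (Nat.find (hfind b))) b
  have hs : Measurable s := Measurable.find (fun n => hR (e n)) (fun n =>
    (hf.measurableSet_piece _).image_of_measurable_injOn hf.measurable (hf.injOn _)) hfind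
  have hfs : Function.LeftInverse f s := by
    intro b
    obtain ⟨a, ha, hab⟩ := Nat.find_spec (hfind b)
    have hRa := hinv _ ha
    rw [hab] at hRa
    exact (congrArg f hRa).trans hab
  have hrange : range s = {a | s (f a) = a} := by
    ext a
    exact ⟨fun ⟨b, hb⟩ => by rw [← hb, mem_ofPred_eq, hfs], fun ha => ⟨f a, ha⟩⟩
  refine ⟨s, .of_measurable_inverse hs ?_ hf.measurable hfs, hfs⟩
  rw [hrange]
  exact measurableSet_eq_fun (hs.comp hf.measurable) measurable_id

theorem IsPiecewiseInjective.exists_isLift (hf : IsPiecewiseInjective f q) (μ : Measure β) :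
    ∃ N : Measure α, IsLift f N μ := by
  refine ⟨Measure.sum fun k => pullbackOn f (q ⁻¹' {k}) μ, fun C hC hinj => ?_⟩
  have hpiece := fun k => hC.inter (hf.measurableSet_piece k)
  have hdisj : Pairwise (Function.onFun Disjoint fun k => f '' (C ∩ q ⁻¹' {k})) := by
    intro k l hkl
    refine disjoint_left.2 ?_
    rintro _ ⟨a, ⟨ha, hak⟩, rfl⟩ ⟨a', ⟨ha', hal⟩, he⟩
    obtain rfl := hinj ha' ha he
    exact hkl (hak.symm.trans hal)
  calc Measure.sum (fun k => pullbackOn f (q ⁻¹' {k}) μ) C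
      = ∑' k, μ (f '' (C ∩ q ⁻¹' {k})) := by
        rw [Measure.sum_apply _ hC]
        exact tsum_congr fun k =>
          pullbackOn_apply hf.measurable (hf.measurableSet_piece k) (hf.injOn k) μ hC
    _ = μ (⋃ k, f '' (C ∩ q ⁻¹' {k})) := (measure_iUnion hdisj fun k =>
        (hpiece k).image_of_measurable_injOn hf.measurable (hinj.mono inter_subset_left)).symm
    _ = μ (f '' C) := by
        rw [← image_iUnion, ← inter_iUnion, iUnion_preimage_singleton_eq_univ, inter_univ]

theorem IsLift.unique_right (hf : IsPiecewiseInjective f q)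
    (hsurj : Function.Surjective f) (h : IsLift f N μ) (h' : IsLift f N μ') : μ = μ' := by
  obtain ⟨s, hs, hfs⟩ := hf.exists_rightInverse hsurj
  ext A hA
  have hinj : InjOn f (s '' A) := hfs.rightInvOn_range.injOn.mono (image_subset_range s A)
  rw [← hfs.image_image A, ← h _ (hs.measurableSet_image.2 hA) hinj,
    h' _ (hs.measurableSet_image.2 hA) hinj]

theorem IsRelInvariant.exists_isLift (hf : IsPiecewiseInjective f q)
    (hsurj : Function.Surjective f) (hN : IsRelInvariant (fun a a' => f a' = f a) N) :
    ∃ μ : Measure β, IsLift f N μ := by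
  obtain ⟨s, hs, hfs⟩ := hf.exists_rightInverse hsurj
  refine ⟨N.comap s, fun C hC hinj => ?_⟩
  have hsf : InjOn (s ∘ f) C := hs.injective.comp_injOn hinj
  rw [hs.comap_apply, ← image_comp]
  exact (hN C (s ∘ f) hC (hs.measurable.comp hf.measurable) hsf fun a _ => hfs (f a)).symm

theorem IsLift.map_eq_iff (hf : IsPiecewiseInjective f q)
    (hsurj : Function.Surjective f) (h : IsLift f N μ) (τ : α ≃ᵐ α) (θ : β ≃ᵐ β)
    (hτθ : f ∘ τ = θ ∘ f) : N.map τ = N ↔ μ.map θ = μ := by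
  have h' := h.map τ θ hτθ
  constructor
  · intro hN
    exact IsLift.unique_right hf hsurj (hN ▸ h') h
  · intro hμ
    exact IsLift.unique_left hf (hμ ▸ h') h

end Lifts

section ProductsWithLebesgue

variable {Z Z' : Type*}

/-- The map of `Z × ℝ` which moves `(z, s)` to the fibre over the first component of `G z` and
translates it by the second component of `G z`. -/
def shear (G : Z → Z' × ℝ) (w : Z × ℝ) : Z' × ℝ := ((G w.1).1, w.2 + (G w.1).2)

theorem injOn_shear {G : Z → Z' × ℝ} {D : Set Z} (hinj : InjOn (fun z => (G z).1) D) :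
    InjOn (shear G) (D ×ˢ univ) := by
  rintro ⟨z, s⟩ hz ⟨z', s'⟩ hz' he
  obtain ⟨hfst, hsnd⟩ := Prod.ext_iff.1 he
  obtain rfl := hinj hz.1 hz'.1 hfst
  exact congrArg (Prod.mk z) (add_right_cancel hsnd)

variable [MeasurableSpace Z'] [MeasurableSpace Z]

/-- The translation by `t` of the fibres of `Z × ℝ`. -/
def fibreTranslation (Z : Type*) [MeasurableSpace Z] (t : ℝ) : Z × ℝ ≃ᵐ Z × ℝ :=
  (MeasurableEquiv.refl Z).prodCongr (MeasurableEquiv.addLeft t)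

theorem map_fibreTranslation_prod_volume (m : Measure Z) [SFinite m] (t : ℝ) :
    (m.prod volume).map (fibreTranslation Z t) = m.prod volume :=
  ((MeasurePreserving.id m).prod (measurePreserving_add_left volume t)).map_eq

theorem isAddLeftInvariant_map_snd_restrict {N : Measure (Z × ℝ)}
    (hN : ∀ t, N.map (fibreTranslation Z t) = N) {A : Set Z} (hA : MeasurableSet A) :
    ((N.restrict (A ×ˢ univ)).map Prod.snd).IsAddLeftInvariant := by
  refine ⟨fun t => ?_⟩
  have hpre : fibreTranslation Z t ⁻¹' (A ×ˢ univ) = A ×ˢ univ := rfl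
  conv_rhs => rw [← hN t, Measure.restrict_map (fibreTranslation Z t).measurable (hA.prod .univ),
    hpre, Measure.map_map measurable_snd (fibreTranslation Z t).measurable]
  exact Measure.map_map (measurable_const_add t) measurable_snd

theorem exists_eq_smul_volume_of_measure_ne_top (ρ : Measure ℝ) [ρ.IsAddLeftInvariant] {U : Set ℝ}
    (hU : (interior U).Nonempty) (hρU : ρ U ≠ ⊤) : ∃ κ : NNReal, ρ = κ • volume :=
  have : IsFiniteMeasureOnCompacts ρ :=
    ⟨fun _ hK => measure_lt_top_of_isCompact_of_isAddLeftInvariant' hU hρU hK⟩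
  ⟨_, Measure.isAddLeftInvariant_eq_smul ρ volume⟩

theorem exists_eq_prod_volume {N : Measure (Z × ℝ)} (hN : ∀ t, N.map (fibreTranslation Z t) = N)
    {η : ℝ} (hη : 0 < η) (hfin : N (univ ×ˢ Ico 0 η) ≠ ⊤) :
    ∃ m : Measure Z, IsFiniteMeasure m ∧ N = m.prod volume := by
  have hη0 : ENNReal.ofReal η ≠ 0 := by simpa using hη
  let m : Measure Z := (ENNReal.ofReal η)⁻¹ • (N.restrict (univ ×ˢ Ico 0 η)).map Prod.fst
  have hm : ∀ A, MeasurableSet A → m A = (ENNReal.ofReal η)⁻¹ * N (A ×ˢ Ico 0 η) := by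
    intro A hA
    rw [Measure.smul_apply, smul_eq_mul, Measure.map_apply measurable_fst hA,
      Measure.restrict_apply (measurable_fst hA), ← prod_univ, prod_inter_prod, inter_univ,
      univ_inter]
  have hmfin : IsFiniteMeasure m := ⟨by
    rw [hm _ .univ]
    exact ENNReal.mul_lt_top (by simpa using hη) hfin.lt_top⟩
  refine ⟨m, hmfin, (Measure.prod_eq fun A I hA hI => ?_).symm⟩
  let ρ : Measure ℝ := (N.restrict (A ×ˢ univ)).map Prod.snd
  have hρ : ∀ J, MeasurableSet J → ρ J = N (A ×ˢ J) := by
    intro J hJ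
    rw [Measure.map_apply measurable_snd hJ, Measure.restrict_apply (measurable_snd hJ),
      ← univ_prod, prod_inter_prod, univ_inter, inter_univ]
  have := isAddLeftInvariant_map_snd_restrict hN hA
  obtain ⟨κ, hκ⟩ : ∃ κ : NNReal, ρ = κ • volume := by
    refine exists_eq_smul_volume_of_measure_ne_top ρ (U := Ico 0 η) (by simpa using hη) ?_
    rw [hρ _ measurableSet_Ico]
    exact measure_ne_top_of_subset (prod_mono_left (subset_univ A)) hfin
  have hκ_apply : ∀ J, ρ J = κ * volume J := fun J => by
    rw [hκ, Measure.smul_apply, ENNReal.smul_def, smul_eq_mul]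
  have hκm : (κ : ENNReal) = m A := by
    rw [hm A hA, ← hρ _ measurableSet_Ico, hκ_apply, Real.volume_Ico, sub_zero, mul_left_comm,
      ENNReal.inv_mul_cancel hη0 ENNReal.ofReal_ne_top, mul_one]
  rw [← hρ I hI, hκ_apply, hκm]

theorem prod_volume_injective {m m' : Measure Z}
    (h : m.prod volume = m'.prod (volume : Measure ℝ)) : m = m' := by
  ext A -
  have hA := congrArg (fun N => N (A ×ˢ Ico (0 : ℝ) 1)) h
  simpa [Measure.prod_prod] using hA

theorem measurable_shear {G : Z → Z' × ℝ} (hG : Measurable G) : Measurable (shear G) := by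
  unfold shear
  fun_prop

theorem measurePreserving_shear {G : Z → Z' × ℝ} (hG : Measurable G) {m : Measure Z}
    {m' : Measure Z'} [SFinite m] (hm : MeasurePreserving (fun z => (G z).1) m m') :
    MeasurePreserving (shear G) (m.prod volume) (m'.prod volume) :=
  hm.skew_product (g := fun z s => s + (G z).2) (by fun_prop)
    (Filter.Eventually.of_forall fun z => map_add_right_eq_self volume (G z).2)

theorem restrict_prod_volume (m : Measure Z) [SFinite m] (D : Set Z) :
    (m.restrict D).prod (volume : Measure ℝ) = (m.prod volume).restrict (D ×ˢ univ) := by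
  rw [← Measure.prod_restrict, Measure.restrict_univ]

theorem prod_volume_shear_image_of_injOn [StandardBorelSpace Z] [StandardBorelSpace Z']
    {G : Z → Z' × ℝ} (hG : Measurable G) {D : Set Z} (hD : MeasurableSet D)
    (hinj : InjOn (fun z => (G z).1) D) {m : Measure Z} {m' : Measure Z'} [SFinite m] [SFinite m']
    (hm : ∀ B ⊆ D, MeasurableSet B → m' ((fun z => (G z).1) '' B) = m B) {A : Set (Z × ℝ)}
    (hA : MeasurableSet A) (hAD : A ⊆ D ×ˢ univ) :
    (m'.prod volume) (shear G '' A) = (m.prod volume) A := by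
  set h : Z → Z' := fun z => (G z).1
  have hmp : MeasurePreserving h (m.restrict D) (m'.restrict (h '' D)) := by
    refine ⟨by fun_prop, ?_⟩
    ext B hB
    rw [Measure.map_apply (by fun_prop) hB, Measure.restrict_apply (by measurability),
      Measure.restrict_apply hB, ← hm _ inter_subset_right (by measurability),
      image_preimage_inter]
  have hshear := measurePreserving_shear hG hmp
  have hSA := hA.image_of_measurable_injOn hshear.measurable ((injOn_shear hinj).mono hAD)
  have e := hshear.measure_preimage hSA.nullMeasurableSet
  have hAD' : shear G '' A ⊆ (h '' D) ×ˢ univ := by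
    rintro _ ⟨w, hw, rfl⟩
    exact ⟨mem_image_of_mem h (hAD hw).1, trivial⟩
  rw [restrict_prod_volume, restrict_prod_volume,
    Measure.restrict_apply (hshear.measurable hSA), Measure.restrict_apply hSA,
    (injOn_shear hinj).preimage_image_inter hAD, inter_eq_left.2 hAD'] at e
  exact e.symm

end ProductsWithLebesgue

section CrossSections

variable {X Z ι : Type*} [TopologicalSpace X]

/-- The map `(z, s) ↦ φ s (p z)`, which sweeps out the space from the points `p z`. -/
def sweep (φ : Flow ℝ X) (p : Z → X) (w : Z × ℝ) : X := φ w.2 (p w.1)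

/-- The indices `z` and `z'` label points `p z` and `p z'` of the same orbit of `φ`. -/
def SameOrbit (φ : Flow ℝ X) (p : Z → X) (z z' : Z) : Prop := p z' ∈ φ.orbit (p z)

/-- The measurable map `p : Z → X` is a cross section of the flow `φ`, coloured by `c`: every orbit
meets it, and it takes at least the time `ε` to go from a point of `Z` to another one of the same
colour. -/
structure IsCrossSection [MeasurableSpace X] [MeasurableSpace Z] [MeasurableSpace ι]
    (φ : Flow ℝ X) (p : Z → X) (c : Z → ι) (ε : ℝ) : Prop where
  measurable : Measurable p
  measurable_color : Measurable c
  pos : 0 < ε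
  eq_of_apply_eq : ∀ ⦃z z' : Z⦄ ⦃t : ℝ⦄, c z = c z' → |t| < ε → φ t (p z) = p z' → t = 0 ∧ z = z'
  surjective : Function.Surjective (sweep φ p)

/-- The colour of the base point and the time interval `[kε, (k + 1)ε)` of a point of `Z × ℝ`. -/
noncomputable def boxIndex (c : Z → ι) (ε : ℝ) (w : Z × ℝ) : ι × ℤ := (c w.1, ⌊w.2 / ε⌋)

/-- `G` is a holonomy map of the cross section `p` with domain `D`: it sends `z ∈ D` to a pair
`(z', t)` such that the flow takes `p z'` to `p z` in the time `t`, and `z'` determines `z`. -/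
structure IsHolonomy [MeasurableSpace Z] (φ : Flow ℝ X) (p : Z → X) (G : Z → Z × ℝ)
    (D : Set Z) : Prop where
  measurable : Measurable G
  measurableSet : MeasurableSet D
  injOn : InjOn (fun z => (G z).1) D
  sweep_eq : ∀ z ∈ D, sweep φ p (G z) = p z

variable {φ : Flow ℝ X} {p : Z → X} {c : Z → ι} {ε : ℝ}

theorem flow_apply_eq_iff_eq_apply_neg (t : ℝ) (x y : X) : φ t x = y ↔ x = φ (-t) y :=
  ((φ.toHomeomorph t).toEquiv.eq_symm_apply).symm

theorem sweep_add (z : Z) (s t : ℝ) : sweep φ p (z, t + s) = φ t (sweep φ p (z, s)) :=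
  φ.map_add t s (p z)

theorem isInvariantMeasure_iff_map_eq [MeasurableSpace X] [BorelSpace X] {μ : Measure X} :
    φ.IsInvariantMeasure μ ↔ ∀ t, μ.map (φ.toHomeomorph t).toMeasurableEquiv = μ := by
  have himage : ∀ (t : ℝ) (A : Set X),
      (φ.toHomeomorph (-t)).toMeasurableEquiv ⁻¹' A = φ t '' A := fun t A =>
    (φ.image_eq_preimage_symm t A).symm
  calc φ.IsInvariantMeasure μ
      ↔ ∀ t, μ.map (φ.toHomeomorph (-t)).toMeasurableEquiv = μ := by
        simp only [Measure.ext_iff, MeasurableEquiv.map_apply, himage]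
        rfl
    _ ↔ ∀ t, μ.map (φ.toHomeomorph t).toMeasurableEquiv = μ :=
        (neg_surjective.forall (p := fun t => μ.map (φ.toHomeomorph t).toMeasurableEquiv = μ)).symm

theorem sweep_comp_fibreTranslation [MeasurableSpace X] [BorelSpace X] [MeasurableSpace Z] (t : ℝ) :
    sweep φ p ∘ fibreTranslation Z t = (φ.toHomeomorph t).toMeasurableEquiv ∘ sweep φ p :=
  funext fun w => sweep_add w.1 w.2 t

theorem sweep_eq_sweep_iff {w w' : Z × ℝ} :
    sweep φ p w = sweep φ p w' ↔ φ (w.2 - w'.2) (p w.1) = p w'.1 := by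
  rw [sub_eq_neg_add, φ.map_add, flow_apply_eq_iff_eq_apply_neg, neg_neg]
  rfl

theorem sameOrbit_of_sweep_eq {z : Z} {w : Z × ℝ} (h : sweep φ p w = p z) :
    SameOrbit φ p z w.1 :=
  ⟨-w.2, ((flow_apply_eq_iff_eq_apply_neg _ _ _).1 h).symm⟩

theorem abs_sub_lt_of_boxIndex_eq (hε : 0 < ε) {w w' : Z × ℝ}
    (h : boxIndex c ε w = boxIndex c ε w') : |w.2 - w'.2| < ε := by
  have hfloor := Int.abs_sub_lt_one_of_floor_eq_floor (congrArg Prod.snd h)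
  rwa [← sub_div, abs_div, abs_of_pos hε, div_lt_one hε] at hfloor

theorem IsHolonomy.sweep_shear [MeasurableSpace Z] {G : Z → Z × ℝ} {D : Set Z}
    (hG : IsHolonomy φ p G D) {w : Z × ℝ} (hw : w.1 ∈ D) :
    sweep φ p (shear G w) = sweep φ p w :=
  (sweep_add _ _ _).trans (congrArg (φ w.2) (hG.sweep_eq w.1 hw))

section Invariance

variable [MeasurableSpace Z] [StandardBorelSpace Z] {G : Z → Z × ℝ} {D : Set Z} {m : Measure Z}

theorem IsHolonomy.prod_volume_shear_image (hG : IsHolonomy φ p G D) [SFinite m]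
    (hm : IsRelInvariant (SameOrbit φ p) m) {A : Set (Z × ℝ)} (hA : MeasurableSet A)
    (hAD : A ⊆ D ×ˢ univ) : (m.prod volume) (shear G '' A) = (m.prod volume) A := by
  refine prod_volume_shear_image_of_injOn hG.measurable hG.measurableSet hG.injOn
    (fun B hBD hB => ?_) hA hAD
  exact hm B _ hB hG.measurable.fst (hG.injOn.mono hBD) fun z hz =>
    sameOrbit_of_sweep_eq (hG.sweep_eq z (hBD hz))

theorem IsHolonomy.measure_image (hG : IsHolonomy φ p G D) [IsFiniteMeasure m]
    (hm : IsRelInvariant (fun w w' => sweep φ p w' = sweep φ p w) (m.prod volume)) {A : Set Z}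
    (hA : MeasurableSet A) (hAD : A ⊆ D) : m ((fun z => (G z).1) '' A) = m A := by
  set h : Z → Z := fun z => (G z).1
  let m' := pullbackOn h D m
  have hm' : ∀ B ⊆ D, MeasurableSet B → m (h '' B) = m' B := fun B hBD hB => by
    rw [pullbackOn_apply hG.measurable.fst hG.measurableSet hG.injOn m hB, inter_eq_left.2 hBD]
  have hAI : MeasurableSet (A ×ˢ Ico (0 : ℝ) 1) := hA.prod measurableSet_Ico
  have hAID : A ×ˢ Ico (0 : ℝ) 1 ⊆ D ×ˢ univ := prod_mono hAD (subset_univ _)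
  have hpull :=
    prod_volume_shear_image_of_injOn hG.measurable hG.measurableSet hG.injOn hm' hAI hAID
  have hinv := hm _ (shear G) hAI (measurable_shear hG.measurable)
    ((injOn_shear hG.injOn).mono hAID) fun w hw => hG.sweep_shear (hAID hw).1
  rw [hm' A hAD hA]
  simpa [Measure.prod_prod] using hpull.symm.trans hinv

end Invariance

namespace IsCrossSection

variable [MeasurableSpace X] [BorelSpace X] [MeasurableSpace Z] [MeasurableSpace ι]

theorem isPiecewiseInjective_sweep (h : IsCrossSection φ p c ε) :
    IsPiecewiseInjective (sweep φ p) (boxIndex c ε) where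
  measurable :=
    φ.cont'.measurable.comp (measurable_snd.prodMk (h.measurable.comp measurable_fst))
  measurable_index := (h.measurable_color.comp measurable_fst).prodMk
    (Int.measurable_floor.comp (measurable_snd.div_const ε))
  eq_of_eq w w' hbox hsweep := by
    obtain ⟨htime, hbase⟩ := h.eq_of_apply_eq (congrArg Prod.fst hbox)
      (abs_sub_lt_of_boxIndex_eq h.pos hbox) (sweep_eq_sweep_iff.1 hsweep)
    exact Prod.ext hbase (sub_eq_zero.1 htime)

variable [MeasurableSingletonClass ι] {m : Measure Z}

theorem isFiniteMeasure_of_isLift [Countable ι] (h : IsCrossSection φ p c ε)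
    [IsFiniteMeasure m] {μ : Measure X} (hm : IsLift (sweep φ p) (m.prod volume) μ)
    {L : ℝ} (hL : ∀ x, ∃ z, ∃ s ∈ Ioo (-L) L, φ s (p z) = x) : IsFiniteMeasure μ := by
  have himage : sweep φ p '' (univ ×ˢ Ioo (-L) L) = univ :=
    eq_univ_of_forall fun x => let ⟨z, s, hs, hx⟩ := hL x; ⟨(z, s), ⟨trivial, hs⟩, hx⟩
  refine ⟨?_⟩
  calc μ univ
      ≤ (m.prod volume) (univ ×ˢ Ioo (-L) L) := himage ▸
        hm.measure_image_le h.isPiecewiseInjective_sweep (MeasurableSet.univ.prod measurableSet_Ioo)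
    _ = m univ * ENNReal.ofReal (L - -L) := by rw [Measure.prod_prod, Real.volume_Ioo]
    _ < ⊤ := ENNReal.mul_lt_top (measure_lt_top m univ) ENNReal.ofReal_lt_top

variable [PolishSpace X] [StandardBorelSpace Z]

theorem exists_holonomy_cover (h : IsCrossSection φ p c ε) :
    ∃ (G : (ι × ℤ) × ι → Z → Z × ℝ) (D : (ι × ℤ) × ι → Set Z),
      (∀ k, IsHolonomy φ p (G k) (D k)) ∧
      ∀ z w, sweep φ p w = p z → ∃ k, z ∈ D k ∧ G k z = w := by
  rcases isEmpty_or_nonempty Z with hZ | hZ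
  · exact ⟨fun _ => isEmptyElim, fun _ => ∅, fun k => ⟨measurable_of_empty _, .empty,
      injOn_empty _, isEmptyElim⟩, isEmptyElim⟩
  have hsw := h.isPiecewiseInjective_sweep
  obtain ⟨R, hR, hinv⟩ := hsw.exists_leftInvOn
  let G : (ι × ℤ) × ι → Z → Z × ℝ := fun k z => R k.1 (p z)
  have hG : ∀ k, Measurable (G k) := fun k => (hR k.1).comp h.measurable
  let D : (ι × ℤ) × ι → Set Z := fun k =>
    {z | sweep φ p (G k z) = p z} ∩ {z | boxIndex c ε (G k z) = k.1} ∩ c ⁻¹' {k.2}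
  refine ⟨G, D, fun k => ⟨hG k, ?_, ?_, fun z hz => hz.1.1⟩, fun z w hw => ?_⟩
  · exact ((measurableSet_eq_fun (hsw.measurable.comp (hG k)) h.measurable).inter
      (hG k (hsw.measurableSet_piece k.1))).inter (h.measurable_color (measurableSet_singleton k.2))
  · rintro z ⟨⟨hz, hbox⟩, hcolor⟩ z' ⟨⟨hz', hbox'⟩, hcolor'⟩ (hfst : (G k z).1 = (G k z').1)
    have htime : φ ((G k z').2 - (G k z).2) (p z) = p z' := by
      rw [← hz.out, ← hz'.out, ← sweep_add, sub_add_cancel, hfst]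
    exact (h.eq_of_apply_eq (hcolor.trans hcolor'.symm)
      (abs_sub_lt_of_boxIndex_eq h.pos (hbox'.trans hbox.symm)) htime).2
  · have hGw : G (boxIndex c ε w, c z) z = w := by
      have hRw := hinv (boxIndex c ε w) (x := w) rfl
      rwa [hw] at hRw
    exact ⟨_, ⟨⟨(congrArg _ hGw).trans hw, congrArg _ hGw⟩, rfl⟩, hGw⟩

section Countable

variable [Countable ι]

theorem isRelInvariant_prod_volume (h : IsCrossSection φ p c ε) [SFinite m]
    (hm : IsRelInvariant (SameOrbit φ p) m) :
    IsRelInvariant (fun w w' => sweep φ p w' = sweep φ p w) (m.prod volume) := by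
  intro C g hC hg hinj hsweep
  obtain ⟨G, D, hG, hcover⟩ := h.exists_holonomy_cover
  refine measure_image_eq_of_countable_cover hg hC hinj
    (S := fun k => D k ×ˢ univ ∩ {w | shear (G k) w = g w})
    (fun k => ((hG k).measurableSet.prod .univ).inter
      (measurableSet_eq_fun (measurable_shear (hG k).measurable) hg)) (fun w hw => ?_) ?_
  · obtain ⟨k, hk, hGk⟩ := hcover w.1 ((g w).1, (g w).2 - w.2)
      (sweep_eq_sweep_iff.1 (hsweep w hw))
    exact mem_iUnion.2 ⟨k, ⟨hk, trivial⟩, by simp [shear, hGk]⟩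
  · intro k A hA hAS
    rw [← image_congr fun w hw => (hAS hw).2.2]
    exact (hG k).prod_volume_shear_image hm hA fun w hw => (hAS hw).2.1

theorem isRelInvariant_of_prod_volume (h : IsCrossSection φ p c ε) [IsFiniteMeasure m]
    (hm : IsRelInvariant (fun w w' => sweep φ p w' = sweep φ p w) (m.prod volume)) :
    IsRelInvariant (SameOrbit φ p) m := by
  intro C g hC hg hinj horbit
  obtain ⟨G, D, hG, hcover⟩ := h.exists_holonomy_cover
  refine measure_image_eq_of_countable_cover hg hC hinj
    (S := fun k => D k ∩ {z | (G k z).1 = g z})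
    (fun k => (hG k).measurableSet.inter
      (measurableSet_eq_fun (hG k).measurable.fst hg)) (fun z hz => ?_) ?_
  · obtain ⟨t, ht⟩ := horbit z hz
    obtain ⟨k, hk, hGk⟩ := hcover z (g z, -t) ((flow_apply_eq_iff_eq_apply_neg t _ _).1 ht).symm
    exact mem_iUnion.2 ⟨k, hk, congrArg Prod.fst hGk⟩
  · intro k A hA hAS
    rw [← image_congr fun z hz => (hAS hz).2.2]
    exact (hG k).measure_image hm hA fun z hz => (hAS hz).2.1

theorem isInvariantMeasure_of_isLift (h : IsCrossSection φ p c ε) [SFinite m] {μ : Measure X}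
    (hm : IsLift (sweep φ p) (m.prod volume) μ) : φ.IsInvariantMeasure μ :=
  isInvariantMeasure_iff_map_eq.2 fun t =>
    (hm.map_eq_iff h.isPiecewiseInjective_sweep h.surjective _ _
      (sweep_comp_fibreTranslation t)).1 (map_fibreTranslation_prod_volume m t)

theorem isRelInvariant_of_isLift (h : IsCrossSection φ p c ε) [IsFiniteMeasure m] {μ : Measure X}
    (hm : IsLift (sweep φ p) (m.prod volume) μ) : IsRelInvariant (SameOrbit φ p) m :=
  h.isRelInvariant_of_prod_volume (hm.isRelInvariant h.isPiecewiseInjective_sweep)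

end Countable

section Finite

variable [Finite ι]

theorem exists_isLift_prod_volume (h : IsCrossSection φ p c ε) {μ : Measure X}
    [IsFiniteMeasure μ] (hμ : φ.IsInvariantMeasure μ) :
    ∃ m : Measure Z, IsFiniteMeasure m ∧ IsLift (sweep φ p) (m.prod volume) μ := by
  have hsw := h.isPiecewiseInjective_sweep
  obtain ⟨N, hN⟩ := hsw.exists_isLift μ
  have hNinv : ∀ t, N.map (fibreTranslation Z t) = N := fun t =>
    (hN.map_eq_iff hsw h.surjective _ _ (sweep_comp_fibreTranslation t)).2
      (isInvariantMeasure_iff_map_eq.1 hμ t)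
  have hcover : univ ×ˢ Ico 0 ε ⊆ ⋃ i ∈ univ, boxIndex c ε ⁻¹' {(i, 0)} := by
    rintro ⟨z, s⟩ ⟨-, hs⟩
    refine mem_biUnion (mem_univ (c z)) (Prod.ext rfl (Int.floor_eq_zero_iff.2 ⟨?_, ?_⟩))
    · exact div_nonneg hs.1 h.pos.le
    · exact (div_lt_one h.pos).2 hs.2
  have hNfin : N (univ ×ˢ Ico 0 ε) ≠ ⊤ := by
    refine measure_ne_top_of_subset hcover (measure_biUnion_lt_top finite_univ fun i _ => ?_).ne
    rw [hN _ (hsw.measurableSet_piece _) (hsw.injOn _)]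
    exact measure_lt_top μ _
  obtain ⟨m, hm, rfl⟩ := exists_eq_prod_volume hNinv h.pos hNfin
  exact ⟨m, hm, hN⟩

theorem exists_equiv_forall_isLift (h : IsCrossSection φ p c ε) {L : ℝ}
    (hL : ∀ x, ∃ z, ∃ s ∈ Ioo (-L) L, φ s (p z) = x) :
    ∃ e : φ.FiniteInvariantMeasure ≃ FiniteRelInvariantMeasure (SameOrbit φ p),
      ∀ μ, IsLift (sweep φ p) ((e μ).1.prod volume) μ.1 := by
  have hsw := h.isPiecewiseInjective_sweep
  have hbase : ∀ μ : φ.FiniteInvariantMeasure, ∃ m : FiniteRelInvariantMeasure (SameOrbit φ p),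
      IsLift (sweep φ p) (m.1.prod volume) μ.1 := by
    rintro ⟨μ, hμ, hinv⟩
    obtain ⟨m, hm, hlift⟩ := h.exists_isLift_prod_volume hinv
    exact ⟨⟨m, hm, h.isRelInvariant_of_isLift hlift⟩, hlift⟩
  have htotal : ∀ m : FiniteRelInvariantMeasure (SameOrbit φ p), ∃ μ : φ.FiniteInvariantMeasure,
      IsLift (sweep φ p) (m.1.prod volume) μ.1 := by
    rintro ⟨m, hm, hinv⟩
    obtain ⟨μ, hlift⟩ := (h.isRelInvariant_prod_volume hinv).exists_isLift hsw h.surjective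
    exact ⟨⟨μ, h.isFiniteMeasure_of_isLift hlift hL, h.isInvariantMeasure_of_isLift hlift⟩, hlift⟩
  choose base hbase using hbase
  choose total htotal using htotal
  refine ⟨⟨base, total, fun μ => Subtype.ext ?_, fun m => Subtype.ext ?_⟩, hbase⟩
  · exact IsLift.unique_right hsw h.surjective (htotal _) (hbase μ)
  · exact prod_volume_injective (IsLift.unique_left hsw (hbase _) (htotal m))

end Finite

end IsCrossSection

end CrossSections

section DisjointUnions

variable {ι : Type*} {α β : ι → Type*} [∀ i, MeasurableSpace (α i)] [∀ i, MeasurableSpace (β i)]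

theorem measurableSet_sigma_iff {A : Set (Σ i, α i)} :
    MeasurableSet A ↔ ∀ i, MeasurableSet (Sigma.mk i ⁻¹' A) :=
  MeasurableSpace.measurableSet_iInf

theorem measurable_sigma_iff {γ : Type*} [MeasurableSpace γ] {f : (Σ i, α i) → γ} :
    Measurable f ↔ ∀ i, Measurable fun a => f ⟨i, a⟩ :=
  ⟨fun hf i _ hA => measurableSet_sigma_iff.1 (hf hA) i,
    fun hf _ hA => measurableSet_sigma_iff.2 fun i => hf i hA⟩

theorem measurableEmbedding_sigmaMk (i : ι) :
    MeasurableEmbedding (Sigma.mk i : α i → Σ i, α i) where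
  injective := sigma_mk_injective
  measurable := measurable_sigma_iff.1 measurable_id i
  measurableSet_image' A hA := measurableSet_sigma_iff.2 fun j => by
    rcases eq_or_ne j i with rfl | hji
    · rwa [preimage_image_eq _ sigma_mk_injective]
    · rw [preimage_image_sigmaMk_of_ne hji]
      exact .empty

instance [Countable ι] [∀ i, StandardBorelSpace (α i)] : StandardBorelSpace (Σ i, α i) := by
  let := fun i => upgradeStandardBorel (α i)
  refine ⟨inferInstance, ⟨?_⟩, inferInstance⟩
  refine le_antisymm (fun A hA => ?_) (MeasurableSpace.generateFrom_le fun A hA => ?_)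
  · let : MeasurableSpace (Σ i, α i) := borel _
    have : BorelSpace (Σ i, α i) := ⟨rfl⟩
    rw [← iUnion_image_preimage_sigma_mk_eq_self A]
    have hmk : ∀ i, MeasurableEmbedding (Sigma.mk i : α i → Σ i, α i) := fun i =>
      Topology.IsOpenEmbedding.sigmaMk.measurableEmbedding
    exact .iUnion fun i => (hmk i).measurableSet_image' (measurableSet_sigma_iff.1 hA i)
  · exact measurableSet_sigma_iff.2 fun i => (hA.preimage continuous_sigmaMk).measurableSet

theorem measure_sigma_ext [Countable ι] {m m' : Measure (Σ i, α i)}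
    (h : ∀ i (A : Set (α i)), MeasurableSet A → m (Sigma.mk i '' A) = m' (Sigma.mk i '' A)) :
    m = m' := by
  ext A hA
  have hdisj : Pairwise (Function.onFun Disjoint fun i => Sigma.mk i '' (Sigma.mk i ⁻¹' A)) := by
    intro i j hij
    refine disjoint_left.2 ?_
    rintro _ ⟨a, -, rfl⟩ ⟨b, -, hb⟩
    exact hij (congrArg Sigma.fst hb).symm
  have hpiece := measurableSet_sigma_iff.1 hA
  have himage := fun i => (measurableEmbedding_sigmaMk i).measurableSet_image.2 (hpiece i)
  rw [← iUnion_image_preimage_sigma_mk_eq_self A, measure_iUnion hdisj himage,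
    measure_iUnion hdisj himage]
  exact tsum_congr fun i => h i _ (hpiece i)

/-- The isomorphism of disjoint unions given by isomorphisms of their members. -/
def measurableSigmaCongr (e : ∀ i, α i ≃ᵐ β i) : (Σ i, α i) ≃ᵐ Σ i, β i where
  toEquiv := .sigmaCongrRight fun i => (e i).toEquiv
  measurable_toFun := measurable_sigma_iff.2 fun i =>
    (measurableEmbedding_sigmaMk i).measurable.comp (e i).measurable
  measurable_invFun := measurable_sigma_iff.2 fun i =>
    (measurableEmbedding_sigmaMk i).measurable.comp (e i).symm.measurable

theorem preimage_measurableSigmaCongr_image (e : ∀ i, α i ≃ᵐ β i) (i : ι) (B : Set (β i)) :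
    measurableSigmaCongr e ⁻¹' (Sigma.mk i '' B) = Sigma.mk i '' (e i ⁻¹' B) := by
  ext z
  constructor
  · rintro ⟨b, hb, hz⟩
    refine ⟨(e i).symm b, by simpa using hb, (measurableSigmaCongr e).injective ?_⟩
    exact (congrArg (Sigma.mk i) ((e i).apply_symm_apply b)).trans hz
  · rintro ⟨a, ha, rfl⟩
    exact ⟨e i a, ha, rfl⟩

end DisjointUnions

section Transversals

variable {X : Type*} [TopologicalSpace X] {φ : Flow ℝ X} {ε : ℝ}

section FlowBoxes

variable {U T : Set X}

theorem eq_of_apply_eq_of_isFlowBox (h : φ.IsFlowBox U T ε) {x y : X} (hx : x ∈ T) (hy : y ∈ T)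
    {s t : ℝ} (hs : s ∈ Ioo (-ε) ε) (ht : t ∈ Ioo (-ε) ε) (heq : φ s x = φ t y) :
    x = y ∧ s = t := by
  obtain ⟨Φ, hΦ⟩ := h.homeo
  have hinj := Φ.injective (a₁ := (⟨x, hx⟩, ⟨s, hs⟩)) (a₂ := (⟨y, hy⟩, ⟨t, ht⟩))
    (Subtype.ext (by rw [hΦ, hΦ]; exact heq))
  simpa using hinj

theorem exists_apply_eq_of_isFlowBox (h : φ.IsFlowBox U T ε) {u : X} (hu : u ∈ U) :
    ∃ x ∈ T, ∃ s ∈ Ioo (-ε) ε, φ s x = u := by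
  obtain ⟨Φ, hΦ⟩ := h.homeo
  obtain ⟨⟨x, s⟩, hxs⟩ := Φ.surjective ⟨u, hu⟩
  exact ⟨x, x.2, s, s.2, by rw [← hΦ, hxs]⟩

theorem measurableSet_of_isTransversal [MeasurableSpace X] [BorelSpace X]
    (h : φ.IsTransversal T) : MeasurableSet T := by
  obtain ⟨U, ε, hU⟩ := h
  have himage := hU.isOpen.measurableSet.subtype_image hU.isClosed.measurableSet
  rwa [show {u : U | (u : X) ∈ T} = (↑) ⁻¹' T from rfl, Subtype.image_preimage_coe,
    inter_eq_right.2 hU.subset] at himage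

end FlowBoxes

variable {n : ℕ} {T : Fin n → Set X}

/-- The inclusion in `X` of the members of the disjoint union of the sets `T i`. -/
def unionPoint (T : Fin n → Set X) (z : Σ i, T i) : X := z.2

theorem injOn_sweep_of_isFlowBox {U : Set X} {i : Fin n} (h : φ.IsFlowBox U (T i) ε)
    (A : Set (T i)) : InjOn (sweep φ (unionPoint T)) ((Sigma.mk i '' A) ×ˢ Ioo (-ε) ε) := by
  rintro ⟨_, s⟩ ⟨⟨x, -, rfl⟩, hs⟩ ⟨_, t⟩ ⟨⟨y, -, rfl⟩, ht⟩ heq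
  obtain ⟨hxy, rfl⟩ := eq_of_apply_eq_of_isFlowBox h x.2 y.2 hs ht heq
  rw [Subtype.ext hxy]

theorem exists_forall_exists_apply_eq [CompactSpace X] (hT : φ.IsCompleteTransversals T) :
    ∃ L : ℝ, ∀ x, ∃ z, ∃ s ∈ Ioo (-L) L, φ s (unionPoint T z) = x := by
  suffices h : ∀ᶠ L : ℝ in Filter.atTop, ∀ x ∈ univ, ∃ z, ∃ s ∈ Ioo (-L) L,
      φ s (unionPoint T z) = x by
    simpa using h.exists
  refine isCompact_univ.induction_on (p := fun S => ∀ᶠ L : ℝ in Filter.atTop, ∀ x ∈ S,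
    ∃ z, ∃ s ∈ Ioo (-L) L, φ s (unionPoint T z) = x) ?_ ?_ ?_ fun x _ => ?_
  · simp
  · exact fun S S' hS h => h.mono fun L hL x hx => hL x (hS hx)
  · exact fun S S' h h' => (h.and h').mono fun L hL x hx => hx.elim (hL.1 x) (hL.2 x)
  · obtain ⟨i, y, hy, t, ht⟩ := hT.2 x
    obtain ⟨U, ε, hU⟩ := hT.1 i
    have hxU : x ∈ φ (-t) ⁻¹' U := by
      rw [mem_preimage, ← (flow_apply_eq_iff_eq_apply_neg t y x).1 ht]
      exact hU.subset hy
    refine ⟨φ (-t) ⁻¹' U, mem_nhdsWithin_of_mem_nhds <|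
      (hU.isOpen.preimage (φ.continuous_toFun (-t))).mem_nhds hxU,
      (Filter.eventually_ge_atTop (|t| + ε)).mono fun L hL u hu => ?_⟩
    obtain ⟨x', hx', s, hs, hsu⟩ := exists_apply_eq_of_isFlowBox hU hu
    refine ⟨⟨i, x', hx'⟩, t + s, ?_, ?_⟩
    · exact abs_lt.1 ((abs_add_le t s).trans_lt (by linarith [abs_lt.2 hs]))
    · rw [φ.map_add, flow_apply_eq_iff_eq_apply_neg]
      exact hsu

variable [MeasurableSpace X]

theorem exists_isCrossSection (hT : φ.IsCompleteTransversals T) :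
    ∃ ε, IsCrossSection φ (unionPoint T) Sigma.fst ε := by
  choose U δ hU using hT.1
  have hδ : ∀ᶠ ε in nhdsWithin (0 : ℝ) (Ioi 0), ∀ i, ε < δ i := Filter.eventually_all.2 fun i =>
    (eventually_lt_nhds (hU i).pos).filter_mono nhdsWithin_le_nhds
  obtain ⟨ε, hεδ, hε⟩ := (hδ.and self_mem_nhdsWithin).exists
  refine ⟨ε, ?_, ?_, hε, ?_, ?_⟩
  · exact measurable_sigma_iff.2 fun i => measurable_subtype_coe
  · exact measurable_sigma_iff.2 fun i => measurable_const
  · rintro ⟨i, x⟩ ⟨j, y⟩ t (rfl : i = j) ht heq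
    have h0 : (0 : ℝ) ∈ Ioo (-δ i) (δ i) := ⟨neg_neg_of_pos (hU i).pos, (hU i).pos⟩
    obtain ⟨hxy, rfl⟩ := eq_of_apply_eq_of_isFlowBox (hU i) x.2 y.2
      (abs_lt.1 (ht.trans (hεδ i))) h0 (heq.trans (φ.map_zero_apply _).symm)
    exact ⟨rfl, congrArg (Sigma.mk i) (Subtype.ext hxy)⟩
  · intro x
    obtain ⟨i, y, hy, t, ht⟩ := hT.2 x
    exact ⟨(⟨i, y, hy⟩, t), ht⟩

theorem IsLift.transverseMeasure_eq {μ : Measure X} {m : Measure (Σ i, T i)}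
    (hm : IsLift (sweep φ (unionPoint T)) (m.prod volume) μ) {U : Set X} {i : Fin n}
    (h : φ.IsFlowBox U (T i) ε) {A : Set (T i)} (hA : MeasurableSet A) :
    φ.transverseMeasure μ ε A = m (Sigma.mk i '' A) := by
  have himage : {z : X | ∃ x ∈ A, ∃ s ∈ Ioo (-ε) ε, z = φ s x} =
      sweep φ (unionPoint T) '' ((Sigma.mk i '' A) ×ˢ Ioo (-ε) ε) := by
    ext z
    constructor
    · rintro ⟨x, hx, s, hs, rfl⟩
      exact ⟨(⟨i, x⟩, s), ⟨⟨x, hx, rfl⟩, hs⟩, rfl⟩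
    · rintro ⟨⟨_, s⟩, ⟨⟨x, hx, rfl⟩, hs⟩, rfl⟩
      exact ⟨x, hx, s, hs, rfl⟩
  have hbox : MeasurableSet ((Sigma.mk i '' A : Set (Σ i, T i)) ×ˢ Ioo (-ε) ε) :=
    ((measurableEmbedding_sigmaMk i).measurableSet_image' hA).prod
      measurableSet_Ioo
  rw [Flow.transverseMeasure, himage, ← hm _ hbox (injOn_sweep_of_isFlowBox h A),
    Measure.prod_prod, Real.volume_Ioo, sub_neg_eq_add, ← two_mul]
  exact ENNReal.mul_div_cancel_right (by simpa using h.pos) ENNReal.ofReal_ne_top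

theorem exists_equiv_forall_isLift [PolishSpace X] [CompactSpace X] [BorelSpace X]
    (hT : φ.IsCompleteTransversals T) :
    ∃ e : φ.FiniteInvariantMeasure ≃ FiniteRelInvariantMeasure (SameOrbit φ (unionPoint T)),
      ∀ μ, IsLift (sweep φ (unionPoint T)) ((e μ).1.prod volume) μ.1 := by
  have := fun i => (measurableSet_of_isTransversal (hT.1 i)).standardBorel
  obtain ⟨ε, h⟩ := exists_isCrossSection hT
  obtain ⟨L, hL⟩ := exists_forall_exists_apply_eq hT
  exact h.exists_equiv_forall_isLift hL

end Transversals

section Correspondence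

variable {X Y : Type*} [TopologicalSpace X] [MeasurableSpace X] [TopologicalSpace Y]
  [MeasurableSpace Y] {φ : Flow ℝ X} {ψ : Flow ℝ Y} {n : ℕ} {T : Fin n → Set X}
  {T' : Fin n → Set Y} {F : ∀ i, T i ≃ᵐ T' i}

theorem carriesTransverseMeasures_iff (hT : φ.IsCompleteTransversals T)
    (hT' : ψ.IsCompleteTransversals T') {μ : Measure X} {ν : Measure Y}
    {m : Measure (Σ i, T i)} {m' : Measure (Σ i, T' i)}
    (hm : IsLift (sweep φ (unionPoint T)) (m.prod volume) μ)
    (hm' : IsLift (sweep ψ (unionPoint T')) (m'.prod volume) ν) :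
    CarriesTransverseMeasures φ ψ (fun i => F i) μ ν ↔ m.map (measurableSigmaCongr F) = m' := by
  have hmap : ∀ i (B : Set (T' i)),
      m.map (measurableSigmaCongr F) (Sigma.mk i '' B) = m (Sigma.mk i '' (F i ⁻¹' B)) := by
    intro i B
    rw [MeasurableEquiv.map_apply, preimage_measurableSigmaCongr_image]
  constructor
  · intro h
    refine measure_sigma_ext fun i B hB => ?_
    obtain ⟨U, ε, hU⟩ := hT.1 i
    obtain ⟨U', ε', hU'⟩ := hT'.1 i
    rw [hmap, ← hm.transverseMeasure_eq hU ((F i).measurable hB), h i U ε U' ε' hU hU' B hB,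
      hm'.transverseMeasure_eq hU' hB]
  · rintro rfl i U ε U' ε' hU hU' B hB
    rw [hm.transverseMeasure_eq hU ((F i).measurable hB), hm'.transverseMeasure_eq hU' hB, hmap]

variable [PolishSpace X] [CompactSpace X] [BorelSpace X] [PolishSpace Y] [CompactSpace Y]
  [BorelSpace Y]

theorem exists_equiv_forall_eq_iff_carriesTransverseMeasures (hT : φ.IsCompleteTransversals T)
    (hT' : ψ.IsCompleteTransversals T') (hF : PreservesHolonomy φ ψ fun i => F i) :
    ∃ Θ : φ.FiniteInvariantMeasure ≃ ψ.FiniteInvariantMeasure,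
      ∀ μ ν, Θ μ = ν ↔ CarriesTransverseMeasures φ ψ (fun i => F i) μ.1 ν.1 := by
  obtain ⟨e, he⟩ := exists_equiv_forall_isLift hT
  obtain ⟨e', he'⟩ := exists_equiv_forall_isLift hT'
  have hF' : ∀ z z', SameOrbit φ (unionPoint T) z z' ↔
      SameOrbit ψ (unionPoint T') (measurableSigmaCongr F z) (measurableSigmaCongr F z') :=
    fun z z' => hF z.1 z'.1 z.2 z'.2
  let E := FiniteRelInvariantMeasure.congr (measurableSigmaCongr F) hF'
  refine ⟨(e.trans E).trans e'.symm, fun μ ν => ?_⟩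
  calc e'.symm (E (e μ)) = ν
      ↔ E (e μ) = e' ν := e'.symm_apply_eq
    _ ↔ (e μ).1.map (measurableSigmaCongr F) = (e' ν).1 := Subtype.ext_iff
    _ ↔ CarriesTransverseMeasures φ ψ (fun i => F i) μ.1 ν.1 :=
        (carriesTransverseMeasures_iff hT hT' (he μ) (he' ν)).symm

end Correspondence

section UniqueErgodicity

open scoped NNReal

variable {X Y : Type*} [TopologicalSpace X] [MeasurableSpace X] [TopologicalSpace Y]
  [MeasurableSpace Y] {φ : Flow ℝ X} {ψ : Flow ℝ Y}

theorem isInvariantMeasure_smul {μ : Measure X} (h : φ.IsInvariantMeasure μ) (a : ENNReal) :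
    φ.IsInvariantMeasure (a • μ) := fun t A hA => by
  rw [Measure.smul_apply, Measure.smul_apply, h t A hA]

noncomputable instance : SMul ℝ≥0 φ.FiniteInvariantMeasure where
  smul a μ := ⟨a • μ.1, have := μ.2.1; inferInstance, isInvariantMeasure_smul μ.2.2 a⟩

theorem val_eq_zero_iff_zero_smul_eq {μ : φ.FiniteInvariantMeasure} :
    μ.1 = 0 ↔ (0 : ℝ≥0) • μ = μ :=
  calc μ.1 = 0
      ↔ (0 : ℝ≥0) • μ.1 = μ.1 := by rw [zero_smul, eq_comm]
    _ ↔ (0 : ℝ≥0) • μ = μ := ⟨fun h => Subtype.ext h, congrArg Subtype.val⟩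

theorem isUniquelyErgodic_iff : φ.IsUniquelyErgodic ↔
    ∃ μ : φ.FiniteInvariantMeasure, μ.1 ≠ 0 ∧ ∀ ν, ∃ a : ℝ≥0, ν = a • μ := by
  have hmul : ∀ μ : Measure X, IsFiniteMeasure μ → NeZero μ → μ univ * (μ univ)⁻¹ = 1 :=
    fun μ _ _ => ENNReal.mul_inv_cancel (NeZero.ne _) (measure_ne_top μ _)
  constructor
  · rintro ⟨μ, ⟨hμ, hinv⟩, hunique⟩
    refine ⟨⟨μ, inferInstance, hinv⟩, IsProbabilityMeasure.ne_zero μ, fun ⟨ν, hν, hνinv⟩ => ?_⟩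
    rcases eq_or_ne ν 0 with rfl | hν0
    · exact ⟨0, Subtype.ext (zero_smul _ μ).symm⟩
    have : NeZero ν := ⟨hν0⟩
    have hnormal := hunique _ ⟨isProbabilityMeasureSMul, isInvariantMeasure_smul hνinv (ν univ)⁻¹⟩
    refine ⟨(ν univ).toNNReal, Subtype.ext ?_⟩
    calc ν = ν univ • (ν univ)⁻¹ • ν := by rw [smul_smul, hmul ν hν this, one_smul]
      _ = (ν univ).toNNReal • μ := by
        rw [hnormal, ← ENNReal.coe_toNNReal (measure_ne_top ν univ)]
        rfl
  · rintro ⟨⟨μ, hμ, hinv⟩, hμ0, hspan⟩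
    have : NeZero μ := ⟨hμ0⟩
    refine ⟨(μ univ)⁻¹ • μ, ⟨isProbabilityMeasureSMul, isInvariantMeasure_smul hinv _⟩, ?_⟩
    rintro ν ⟨hν, hνinv⟩
    obtain ⟨a, ha⟩ := hspan ⟨ν, inferInstance, hνinv⟩
    obtain rfl : ν = (a : ENNReal) • μ := congrArg Subtype.val ha
    have hmass : (a : ENNReal) * μ univ = 1 := hν.measure_univ
    rw [ENNReal.eq_inv_of_mul_eq_one_left hmass]

theorem CarriesTransverseMeasures.smul {n : ℕ} {T : Fin n → Set X} {T' : Fin n → Set Y}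
    {F : ∀ i, T i → T' i} {μ : Measure X} {ν : Measure Y}
    (h : CarriesTransverseMeasures φ ψ F μ ν) (a : ENNReal) :
    CarriesTransverseMeasures φ ψ F (a • μ) (a • ν) := by
  intro i U ε U' ε' hU hU' B hB
  have hB_eq := h i U ε U' ε' hU hU' B hB
  simp only [Flow.transverseMeasure, Measure.smul_apply, smul_eq_mul, mul_div_assoc] at hB_eq ⊢
  rw [hB_eq]

theorem isUniquelyErgodic_congr (Θ : φ.FiniteInvariantMeasure ≃ ψ.FiniteInvariantMeasure)
    (hΘ : ∀ (a : ℝ≥0) μ, Θ (a • μ) = a • Θ μ) : φ.IsUniquelyErgodic ↔ ψ.IsUniquelyErgodic := by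
  simp only [isUniquelyErgodic_iff, Ne, val_eq_zero_iff_zero_smul_eq]
  refine Θ.exists_congr fun μ => and_congr ?_ (Θ.forall_congr fun ν => exists_congr fun a => ?_)
  · rw [← hΘ, Θ.apply_eq_iff_eq]
  · rw [← hΘ, Θ.apply_eq_iff_eq]

end UniqueErgodicity

theorem mainTheorem3_general {X Y : Type*}
    [TopologicalSpace X] [PolishSpace X] [CompactSpace X] [MeasurableSpace X] [BorelSpace X]
    [TopologicalSpace Y] [PolishSpace Y] [CompactSpace Y] [MeasurableSpace Y] [BorelSpace Y]
    {φ : Flow ℝ X} {ψ : Flow ℝ Y} {n : ℕ} {T : Fin n → Set X} {T' : Fin n → Set Y}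
    (hT : φ.IsCompleteTransversals T) (hT' : ψ.IsCompleteTransversals T')
    (F : ∀ i, T i ≃ᵐ T' i) (hF : PreservesHolonomy φ ψ (fun i => (F i : T i → T' i))) :
    (∃ Θ : φ.FiniteInvariantMeasure ≃ ψ.FiniteInvariantMeasure,
      ∀ (μ : φ.FiniteInvariantMeasure) (ν : ψ.FiniteInvariantMeasure),
        Θ μ = ν ↔
          CarriesTransverseMeasures φ ψ (fun i => (F i : T i → T' i)) μ.1 ν.1) ∧
    (φ.IsUniquelyErgodic ↔ ψ.IsUniquelyErgodic) := by
  obtain ⟨Θ, hΘ⟩ := exists_equiv_forall_eq_iff_carriesTransverseMeasures hT hT' hF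
  exact ⟨⟨Θ, hΘ⟩, isUniquelyErgodic_congr Θ fun a μ => (hΘ _ _).2 (((hΘ μ _).1 rfl).smul a)⟩

theorem mainTheorem3 {X Y : Type*}
    [MetricSpace X] [CompactSpace X] [MeasurableSpace X] [BorelSpace X]
    [MetricSpace Y] [CompactSpace Y] [MeasurableSpace Y] [BorelSpace Y]
    (φ : Flow ℝ X) (ψ : Flow ℝ Y)
    (hφ : φ.HasNoFixedPoints) (hψ : ψ.HasNoFixedPoints)
    (n : ℕ) (T : Fin n → Set X) (T' : Fin n → Set Y)
    (hT : φ.IsCompleteTransversals T) (hT' : ψ.IsCompleteTransversals T')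
    (F : ∀ i, T i ≃ₜ T' i)
    (hF : PreservesHolonomy φ ψ (fun i => (F i : T i → T' i))) :
    (∃ Θ : φ.FiniteInvariantMeasure ≃ ψ.FiniteInvariantMeasure,
      ∀ (μ : φ.FiniteInvariantMeasure) (ν : ψ.FiniteInvariantMeasure),
        Θ μ = ν ↔
          CarriesTransverseMeasures φ ψ (fun i => (F i : T i → T' i)) μ.1 ν.1) ∧
    (φ.IsUniquelyErgodic ↔ ψ.IsUniquelyErgodic) :=
  mainTheorem3_general hT hT' (fun i => (F i).toMeasurableEquiv) hF
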